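/- **Setting.** Let $\Lambda$ be a probability distribution on $\mathbb R^n\times\mathbb R$ supported on a compact set $\mathcal X\times\mathcal Y$, and let $(x_t,y_t)_{t\ge 1}$ be independent samples from $\Lambda$. Let $f(\cdot\,;y)=f_y:\mathbb R\to\mathbb R$, $y\in\mathcal Y$, be convex and differentiable loss functions with $L$-Lipschitz derivatives for some $L>0$, such that for every $z\in\mathbb R$ the function $y\mapsto f(z;y)$ is measurable and bounded on $\mathcal Y$. Let $\lambda>0$, let $\mathcal G$ be a partition of $\{1,\dots,n\}$, and let $\Omega(\beta)=\sum_{g\in\mathcal G}\Omega_g(\beta_g)$, where each $\Omega_g$ is a norm on $\mathbb R^{g}$. Let $\mu_t\in(0,1)$ satisfy $\sum_t\mu_t=\infty$ and $\sum_t\mu_t^2<\infty$. The expected objective is $$P(\beta)=\mathbb E_{(x,y)\sim\Lambda}\big[f_y(x^\top\beta)\big]+\lambda\,\Omega(\beta),$$ and the online objective is $\bar P^{(t)}(\beta)=\bar F^{(t)}(\beta)+\lambda\,\Omega(\beta)$, where $$\bar F^{(1)}(\beta)=f_{y_1}(x_1^\top\beta),\qquad \bar F^{(t)}(\beta)=\mu_t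 f_{y_t}(x_t^\top\beta)+(1-\mu_t)\bar F^{(t-1)}(\beta)\quad(t\ge 2).$$ Thus $\bar F^{(t)}(\beta)=\sum_{s\le t}\eta^{(t)}_s f_{y_s}(x_s^\top\beta)$ with positive weights $\eta^{(t)}_s$ that sum to $1$. The dual certificates of $P$ and of $\bar P^{(t)}$ are $$Z^\star=-\tfrac1\lambda\,\mathbb E_{(x,y)\sim\Lambda}\big[f_y'(x^\top\beta^\star)\,x\big],\qquad Z^{*,(t)}=-\tfrac1\lambda\sum_{s\le t}\eta^{(t)}_s f_{y_s}'(x_s^\top\beta^{(t),*})\,x_s,$$ where $\beta^\star$ and $\beta^{(t),*}$ are any global minimizers of $P$ and of $\bar P^{(t)}$, respectively. **Proposition (Convergence of online objectives).** The expectations $\mathbb E[f_y(x^\top\beta)]$ and $\mathbb E[f_y'(x^\top\beta)x]$ exist for every $\beta\in\mathbb R^n$, and the following hold. 1. Almost surely, for every compact set $\mathcal O\subset\mathbb R^n$, $$\sup_{\beta\in\mathcal O}\big|\bar P^{(t)}(\beta)-P(\beta)\big|\to 0\qquad (t\to\infty).$$ 2. Suppose in addition that $f_y$ is bounded below for each $y\in\mathcal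 Y$. Then $P$ has a minimizer, and $Z^\star$ does not depend on the choice of $\beta^\star$. Almost surely, $\bar P^{(t)}$ has a minimizer and $Z^{*,(t)}$ does not depend on the choice of $\beta^{(t),*}$ for all $t$, and $$\big\|Z^{*,(t)}-Z^\star\big\|_\infty\to 0\qquad (t\to\infty).$$ -/

import Mathlib

open MeasureTheory ProbabilityTheory Filter Topology
open scoped NNReal

noncomputable section

/-- Standing assumptions on the loss `f z y = f(z; y)`, for labels `y` in the set `𝒴`: every
`f_y = f(·; y)` is convex and differentiable with `L`-Lipschitz derivative; for every `z`, the
function `f(z; ·)` is measurable and bounded on `𝒴`. -/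
structure IsSmoothConvexLoss (f : ℝ → ℝ → ℝ) (𝒴 : Set ℝ) (L : ℝ≥0) : Prop where
  convex : ∀ y ∈ 𝒴, ConvexOn ℝ Set.univ (fun z => f z y)
  differentiable : ∀ y ∈ 𝒴, Differentiable ℝ (fun z => f z y)
  lipschitz : ∀ y ∈ 𝒴, LipschitzWith L (deriv (fun z => f z y))
  measurable : ∀ z, Measurable (fun y : 𝒴 => f z y)
  bounded : ∀ z, ∃ B : ℝ, ∀ y ∈ 𝒴, |f z y| ≤ B

/-- A group decomposable norm on `ℝⁿ`: a partition of the coordinates into groups and, for each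
group `g`, a norm `Ω_g` (a seminorm that vanishes only at `0`) on `ℝ^g`. -/
structure GroupDecomposableNorm (n : ℕ) where
  groups : Finpartition (Finset.univ : Finset (Fin n))
  groupNorm : (g : groups.parts) → Seminorm ℝ (g.1 → ℝ)
  definite : ∀ (g : groups.parts) (v : g.1 → ℝ), groupNorm g v = 0 → v = 0

/-- `Ω(β) = ∑_g Ω_g(β_g)`. -/
def GroupDecomposableNorm.eval {n : ℕ} (Ω : GroupDecomposableNorm n) (β : Fin n → ℝ) : ℝ :=
  ∑ g : Ω.groups.parts, Ω.groupNorm g (fun i => β i.1)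

/-- The exponentially weighted average `ā` of a sequence `a`, with weights `μ`:
`ā 0 = a 0` and `ā t = μ t • a t + (1 - μ t) • ā (t - 1)` for `t ≥ 1`.
(Time starts at `0`; the weight `μ 0` is not used.) -/
def onlineAverage {E : Type*} [AddCommGroup E] [Module ℝ E] (μ : ℕ → ℝ) (a : ℕ → E) : ℕ → E
  | 0 => a 0
  | t + 1 => μ (t + 1) • a (t + 1) + (1 - μ (t + 1)) • onlineAverage μ a t

/-- The loss `f_y(xᵀβ)` of the sample `p = (x, y)` at `β`. -/
def sampleLoss {n : ℕ} (f : ℝ → ℝ → ℝ) (β : Fin n → ℝ) (p : (Fin n → ℝ) × ℝ) : ℝ :=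
  f (dotProduct p.1 β) p.2

/-- The vector `f_y'(xᵀβ) x` of the sample `p = (x, y)` at `β`. -/
def sampleGrad {n : ℕ} (f : ℝ → ℝ → ℝ) (β : Fin n → ℝ) (p : (Fin n → ℝ) × ℝ) : Fin n → ℝ :=
  deriv (fun z => f z p.2) (dotProduct p.1 β) • p.1

/-- The expected objective `P(β) = 𝔼_{(x,y) ∼ Λ}[f_y(xᵀβ)] + lam Ω(β)`. -/
def expectedObjective {n : ℕ} (f : ℝ → ℝ → ℝ) (Ω : GroupDecomposableNorm n) (lam : ℝ)
    (Λ : Measure ((Fin n → ℝ) × ℝ)) (β : Fin n → ℝ) : ℝ :=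
  (∫ p, sampleLoss f β p ∂Λ) + lam * Ω.eval β

/-- The online objective `P̄^{(t)}(β)` built from the samples `p 0, …, p t`. -/
def onlineObjective {n : ℕ} (f : ℝ → ℝ → ℝ) (Ω : GroupDecomposableNorm n) (lam : ℝ)
    (μ : ℕ → ℝ) (p : ℕ → (Fin n → ℝ) × ℝ) (t : ℕ) (β : Fin n → ℝ) : ℝ :=
  onlineAverage μ (fun s => sampleLoss f β (p s)) t + lam * Ω.eval β

/-- `Z` is a dual certificate of the expected objective: `Z = -(1/lam) 𝔼[f_y'(xᵀβ*) x]` for some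
global minimizer `β*` of `P`. -/
def IsExpectedCertificate {n : ℕ} (f : ℝ → ℝ → ℝ) (Ω : GroupDecomposableNorm n) (lam : ℝ)
    (Λ : Measure ((Fin n → ℝ) × ℝ)) (Z : Fin n → ℝ) : Prop :=
  ∃ β, IsMinOn (expectedObjective f Ω lam Λ) Set.univ β ∧
    Z = -(1 / lam) • ∫ p, sampleGrad f β p ∂Λ

/-- `Z` is a dual certificate of the online objective `P̄^{(t)}`: it is `-(1/lam)` times the
weighted average of the vectors `f_{y_s}'(x_sᵀβ) x_s`, `s ≤ t`, for some global minimizer `β` of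
`P̄^{(t)}`. -/
def IsOnlineCertificate {n : ℕ} (f : ℝ → ℝ → ℝ) (Ω : GroupDecomposableNorm n) (lam : ℝ)
    (μ : ℕ → ℝ) (p : ℕ → (Fin n → ℝ) × ℝ) (t : ℕ) (Z : Fin n → ℝ) : Prop :=
  ∃ β, IsMinOn (onlineObjective f Ω lam μ p t) Set.univ β ∧
    Z = -(1 / lam) • onlineAverage μ (fun s => sampleGrad f β (p s)) t

end

/-! The online objective is the expected objective with `Λ` replaced by the weighted empirical
measure `onlineMeasure`, a probability measure that almost surely lives on the same bounded set of
samples. Convexity, coercivity and uniqueness of certificates are therefore proved once, for any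
probability measure on that set.

Uniform convergence: for fixed `β`, the centred losses weighted by `μ t` form an almost surely
convergent series, because `∑ μ t ^ 2 < ∞` (Kolmogorov). A Kronecker-type lemma, which uses `∑ μ t =
∞`, turns this into convergence of the online averages. Losses and gradients are bounded and
Lipschitz in `β` on balls, uniformly over the samples, so convergence on a countable dense set of
`β` becomes uniform on compact sets.

Certificates: minimizers need be neither unique nor convergent. Instead, cocoercivity of the
derivative bounds the squared difference between the expected gradients at a point and at a
minimizer by the optimality gap (`sq_integral_sampleGrad_sub_le`). Gap zero gives uniqueness. For
convergence, coercivity of the limit traps the online minimizers in a fixed ball, where uniform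
convergence makes them nearly optimal for `P`. -/

/-! ### Exponentially weighted averages and their strong law. -/

theorem onlineAverage_tendsto_zero {μ a : ℕ → ℝ} (hμ : ∀ t, μ t ∈ Set.Ioo (0 : ℝ) 1)
    (hμ_sum : Tendsto (fun T => ∑ t ∈ Finset.range T, μ t) atTop atTop)
    (ha : Tendsto a atTop (𝓝 0)) : Tendsto (onlineAverage μ a) atTop (𝓝 0) := by
  rw [Metric.tendsto_atTop]
  intro ε hε
  obtain ⟨N, hN⟩ := Metric.tendsto_atTop.1 ha (ε / 2) (by positivity)
  set A : ℕ → ℝ := fun T => ∑ t ∈ Finset.range T, μ t with hA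
  set u := onlineAverage μ a with hu
  -- After time `N` the terms contribute at most `ε / 2`, and the weight left on `u N` is a product
  -- of factors `1 - μ ≤ exp (-μ)`, which vanishes because `∑ μ` diverges.
  have key : ∀ k, |u (N + k)| ≤ ε / 2 + Real.exp (-(A (N + k + 1) - A (N + 1))) * |u N| := by
    intro k
    induction k with
    | zero => simp; positivity
    | succ k ih =>
      have h1 := hμ (N + k + 1)
      have h2 : |a (N + k + 1)| ≤ ε / 2 := by
        have := hN (N + k + 1) (by omega)
        rw [Real.dist_eq, sub_zero] at this
        exact this.le
      have h3 : u (N + (k + 1)) = μ (N + k + 1) * a (N + k + 1) + (1 - μ (N + k + 1)) * u (N + k) :=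
        rfl
      have h4 : A (N + (k + 1) + 1) = A (N + k + 1) + μ (N + k + 1) :=
        Finset.sum_range_succ _ _
      have h5 : 1 - μ (N + k + 1) ≤ Real.exp (-μ (N + k + 1)) := by
        have := Real.add_one_le_exp (-μ (N + k + 1)); linarith
      have h6 : Real.exp (-(A (N + (k + 1) + 1) - A (N + 1)))
          = Real.exp (-μ (N + k + 1)) * Real.exp (-(A (N + k + 1) - A (N + 1))) := by
        rw [← Real.exp_add, h4]; congr 1; ring
      have hpos : 0 < 1 - μ (N + k + 1) := by linarith [h1.2]
      calc |u (N + (k + 1))|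
          ≤ μ (N + k + 1) * |a (N + k + 1)| + (1 - μ (N + k + 1)) * |u (N + k)| := by
            rw [h3]
            refine (abs_add_le _ _).trans_eq ?_
            rw [abs_mul, abs_mul, abs_of_pos h1.1, abs_of_pos hpos]
        _ ≤ μ (N + k + 1) * (ε / 2) + (1 - μ (N + k + 1)) *
              (ε / 2 + Real.exp (-(A (N + k + 1) - A (N + 1))) * |u N|) :=
            add_le_add (mul_le_mul_of_nonneg_left h2 h1.1.le)
              (mul_le_mul_of_nonneg_left ih hpos.le)
        _ = ε / 2 + (1 - μ (N + k + 1)) * (Real.exp (-(A (N + k + 1) - A (N + 1))) * |u N|) := by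
            ring
        _ ≤ _ := by
            rw [h6, mul_assoc]
            gcongr
  have hlim : Tendsto (fun T => Real.exp (-(A (T + 1) - A (N + 1))) * |u N|) atTop (𝓝 0) := by
    rw [← zero_mul |u N|]
    refine Tendsto.mul_const _ (Real.tendsto_exp_neg_atTop_nhds_zero.comp ?_)
    exact tendsto_atTop_add_const_right _ _ (hμ_sum.comp (tendsto_add_atTop_nat 1))
  obtain ⟨M, hM⟩ := Metric.tendsto_atTop.1 hlim (ε / 2) (by positivity)
  refine ⟨max M N, fun t ht => ?_⟩
  obtain ⟨k, rfl⟩ := Nat.exists_eq_add_of_le ((le_max_right M N).trans ht)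
  have h1 := key k
  have h2 := hM (N + k) ((le_max_left M N).trans ht)
  rw [Real.dist_eq, sub_zero] at h2 ⊢
  linarith [le_abs_self (Real.exp (-(A (N + k + 1) - A (N + 1))) * |u N|)]

theorem onlineAverage_sub_const {μ a : ℕ → ℝ} (c : ℝ) (t : ℕ) :
    onlineAverage μ (fun s => a s - c) t = onlineAverage μ a t - c := by
  induction t with
  | zero => rfl
  | succ t ih => simp only [onlineAverage, ih, smul_eq_mul]; ring

/-- A form of Kronecker's lemma. -/
theorem onlineAverage_tendsto_zero_of_series {μ b : ℕ → ℝ} (hμ : ∀ t, μ t ∈ Set.Ioo (0 : ℝ) 1)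
    (hμ_sum : Tendsto (fun T => ∑ t ∈ Finset.range T, μ t) atTop atTop) {s : ℝ}
    (hs : Tendsto (fun T => ∑ t ∈ Finset.range T, μ t * b t) atTop (𝓝 s)) :
    Tendsto (onlineAverage μ b) atTop (𝓝 0) := by
  set B : ℕ → ℝ := fun T => ∑ t ∈ Finset.range T, μ t * b t with hB
  -- the average of the remainders, started at a suitable value
  set a : ℕ → ℝ := fun t => if t = 0 then b 0 - B 1 + s else s - B t with ha
  have ha0 : Tendsto a atTop (𝓝 0) := by
    have h : Tendsto (fun t => s - B t) atTop (𝓝 0) := by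
      simpa using hs.const_sub s
    refine h.congr' ?_
    filter_upwards [eventually_ne_atTop 0] with t ht
    simp [ha, ht]
  -- Summation by parts: `onlineAverage μ b t - B (t + 1) + s` obeys the averaging recursion with
  -- input `s - B t`. The special value `a 0` makes the identity start correctly, since `B` contains
  -- the term `μ 0 * b 0`.
  have hw : ∀ t, onlineAverage μ b t = onlineAverage μ a t + B (t + 1) - s := by
    intro t
    induction t with
    | zero => simp only [onlineAverage, ha, if_true]; ring
    | succ t ih =>
      have h4 : B (t + 1 + 1) = B (t + 1) + μ (t + 1) * b (t + 1) := Finset.sum_range_succ _ _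
      simp only [onlineAverage, ih, smul_eq_mul, h4]
      simp only [ha, Nat.add_eq_zero_iff, one_ne_zero, and_false, if_false]
      ring
  have h1 := ((onlineAverage_tendsto_zero hμ hμ_sum ha0).add
    (hs.comp (tendsto_add_atTop_nat 1))).sub_const s
  simp only [zero_add, sub_self] at h1
  exact h1.congr fun t => (hw t).symm

/-- **Kolmogorov's convergence theorem**: a series of independent centred random variables with
summable variances converges almost surely. -/
theorem ae_exists_tendsto_sum_of_summable_variance {S : Type*} [MeasurableSpace S] {Pr : Measure S}
    [IsProbabilityMeasure Pr] {X : ℕ → S → ℝ} (hX : ∀ t, StronglyMeasurable (X t))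
    (hL2 : ∀ t, MemLp (X t) 2 Pr) (hmean : ∀ t, ∫ ω, X t ω ∂Pr = 0) (hindep : iIndepFun X Pr)
    (hvar : Summable fun t => variance (X t) Pr) :
    ∀ᵐ ω ∂Pr, ∃ s, Tendsto (fun T => ∑ t ∈ Finset.range T, X t ω) atTop (𝓝 s) := by
  -- The index shift makes the increment after time `T` equal to `X (T + 1)`, which is independent
  -- of the natural filtration at `T`.
  set M : ℕ → S → ℝ := fun T => ∑ t ∈ Finset.range (T + 1), X t with hM
  have hMs : ∀ T, M (T + 1) - M T = X (T + 1) := fun T => by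
    simp only [hM]; rw [Finset.sum_range_succ _ (T + 1)]; abel
  have hML2 : ∀ T, MemLp (M T) 2 Pr := fun T => memLp_finsetSum' _ fun t _ => hL2 t
  have hint : ∀ t, Integrable (X t) Pr := fun t => (hL2 t).integrable (by norm_num)
  have hMmean : ∀ T, ∫ ω, M T ω ∂Pr = 0 := fun T => by
    simp only [hM, Finset.sum_apply]
    rw [integral_finsetSum _ fun t _ => hint t]
    simp [hmean]
  have hmart : Martingale M (Filtration.natural X hX) Pr := by
    refine martingale_of_condExp_sub_eq_zero_nat (fun T => ?_)
      (fun T => (hML2 T).integrable (by norm_num)) fun T => ?_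
    · refine Finset.stronglyMeasurable_sum _ fun t ht => ?_
      exact (Filtration.stronglyAdapted_natural hX t).mono
        ((Filtration.natural X hX).mono (by simpa [Nat.lt_succ_iff] using ht))
    · rw [hMs]
      refine (hindep.condExp_natural_ae_eq_of_lt hX T.lt_succ_self).trans ?_
      simp only [hmean]; rfl
  set V := ∑' t, variance (X t) Pr with hV
  have hV0 : 0 ≤ 1 + V := add_nonneg zero_le_one (tsum_nonneg fun t => variance_nonneg _ _)
  have hbdd : ∀ T, eLpNorm (M T) 1 Pr ≤ ((1 + V).toNNReal : ENNReal) := by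
    intro T
    have hv : variance (M T) Pr ≤ V := by
      simp only [hM]
      rw [IndepFun.variance_sum (fun t _ => hL2 t) fun i _ j _ hij => hindep.indepFun hij]
      exact hvar.sum_le_tsum _ fun t _ => variance_nonneg _ _
    rw [variance_of_integral_eq_zero (hML2 T).aestronglyMeasurable.aemeasurable (hMmean T)] at hv
    rw [eLpNorm_one_eq_lintegral_enorm,
      ← ofReal_integral_norm_eq_lintegral_enorm ((hML2 T).integrable (by norm_num)),
      ENNReal.ofReal_le_iff_le_toReal ENNReal.coe_ne_top]
    rw [ENNReal.coe_toReal, Real.coe_toNNReal _ hV0]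
    -- Martingale convergence needs only an `L¹` bound, and `|x| ≤ 1 + x ^ 2` extracts one from the
    -- variance.
    calc ∫ ω, ‖M T ω‖ ∂Pr ≤ ∫ ω, (1 + M T ω ^ 2) ∂Pr := by
          refine integral_mono ((hML2 T).integrable (by norm_num)).norm
            ((integrable_const _).add (hML2 T).integrable_sq) fun ω => ?_
          simp only [Real.norm_eq_abs]
          nlinarith [sq_abs (M T ω), sq_nonneg (|M T ω| - 1)]
      _ = 1 + ∫ ω, M T ω ^ 2 ∂Pr := by
          rw [integral_add (integrable_const _) (hML2 T).integrable_sq]; simp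
      _ ≤ 1 + V := by linarith
  filter_upwards [hmart.submartingale.exists_ae_tendsto_of_bdd hbdd] with ω ⟨s, hs⟩
  refine ⟨s, (tendsto_add_atTop_iff_nat 1).1 (hs.congr fun T => ?_)⟩
  simp [hM]

/-- The strong law of large numbers for exponentially weighted averages of a bounded function of
independent samples with law `Λ`. -/
theorem ae_tendsto_onlineAverage {T S : Type*} [MeasurableSpace T] [MeasurableSpace S]
    {Λ : Measure T} [IsProbabilityMeasure Λ] {Pr : Measure S} [IsProbabilityMeasure Pr]
    {ξ : ℕ → S → T} (hξ_law : ∀ t, HasLaw (ξ t) Λ Pr) (hξ_indep : iIndepFun ξ Pr)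
    {μ : ℕ → ℝ} (hμ : ∀ t, μ t ∈ Set.Ioo (0 : ℝ) 1)
    (hμ_sum : Tendsto (fun T => ∑ t ∈ Finset.range T, μ t) atTop atTop)
    (hμ_sq : Summable (fun t => μ t ^ 2))
    {g : T → ℝ} (hg : AEMeasurable g Λ) {C : ℝ} (hC : ∀ᵐ p ∂Λ, |g p| ≤ C) :
    ∀ᵐ ω ∂Pr, Tendsto (fun t => onlineAverage μ (fun s => g (ξ s ω)) t) atTop
      (𝓝 (∫ p, g p ∂Λ)) := by
  set m := ∫ p, g p ∂Λ with hm
  have hgi : MemLp g 2 Λ := MemLp.of_bound hg.aestronglyMeasurable C hC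
  have hgξ : ∀ t, AEMeasurable (fun ω => g (ξ t ω)) Pr := fun t =>
    AEMeasurable.comp_aemeasurable (by rw [(hξ_law t).map_eq]; exact hg) (hξ_law t).aemeasurable
  -- `g` is only a.e. measurable, while the martingale argument wants genuinely measurable
  -- variables.
  set Y : ℕ → S → ℝ := fun t => (hgξ t).mk with hY
  have hYae : ∀ t, Y t =ᵐ[Pr] fun ω => g (ξ t ω) := fun t => (hgξ t).ae_eq_mk.symm
  have hgL2 : ∀ t, MemLp (fun ω => g (ξ t ω)) 2 Pr := fun t => by
    have h := hgi
    rw [← (hξ_law t).map_eq] at h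
    exact h.comp_of_map (hξ_law t).aemeasurable
  have hYL2 : ∀ t, MemLp (Y t) 2 Pr := fun t => (memLp_congr_ae (hYae t)).2 (hgL2 t)
  have hYm : ∀ t, Measurable (Y t) := fun t => (hgξ t).measurable_mk
  have hYindep : iIndepFun Y Pr := by
    have h : iIndepFun (fun t ω => g (ξ t ω)) Pr :=
      hξ_indep.comp₀ (fun _ => g) (fun t => (hξ_law t).aemeasurable)
        fun t => by rw [(hξ_law t).map_eq]; exact hg
    exact h.congr fun t => (hYae t).symm
  have hYmean : ∀ t, ∫ ω, Y t ω ∂Pr = m := fun t => by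
    rw [integral_congr_ae (hYae t)]
    exact (hξ_law t).integral_comp hg.aestronglyMeasurable
  have hYvar : ∀ t, variance (Y t) Pr = variance g Λ := fun t => by
    rw [variance_congr (hYae t), ← (hξ_law t).map_eq,
      variance_map (by rw [(hξ_law t).map_eq]; exact hg) (hξ_law t).aemeasurable]
    rfl
  have hser := ae_exists_tendsto_sum_of_summable_variance (Pr := Pr)
    (X := fun t ω => μ t * (Y t ω - m))
    (fun t => (measurable_const.mul ((hYm t).sub_const m)).stronglyMeasurable)
    (fun t => ((hYL2 t).sub (memLp_const m)).const_mul (μ t))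
    (fun t => by
      rw [integral_const_mul, integral_sub ((hYL2 t).integrable (by norm_num)) (integrable_const _),
        hYmean t]
      simp)
    (hYindep.comp (fun t x => μ t * (x - m)) fun t => by fun_prop)
    (by
      have : (fun t => variance (fun ω => μ t * (Y t ω - m)) Pr)
          = fun t => μ t ^ 2 * variance g Λ := by
        funext t
        rw [variance_const_mul, variance_sub_const (hYm t).aestronglyMeasurable, hYvar t]
      rw [this]
      exact hμ_sq.mul_right _)
  filter_upwards [hser, ae_all_iff.2 hYae] with ω ⟨s, hs⟩ hω
  have h1 := onlineAverage_tendsto_zero_of_series (b := fun t => Y t ω - m) hμ hμ_sum hs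
  have h2 := h1.add_const m
  rw [zero_add] at h2
  refine h2.congr fun t => ?_
  rw [onlineAverage_sub_const]
  simp [hω]

/-! ### Weighted empirical measures -/

/-- The weighted empirical measure of the samples `p 0, …, p t`: integration against it is
`onlineAverage`. -/
noncomputable def onlineMeasure {T : Type*} [MeasurableSpace T] (μ : ℕ → ℝ) (p : ℕ → T) :
    ℕ → Measure T
  | 0 => Measure.dirac (p 0)
  | t + 1 => ENNReal.ofReal (μ (t + 1)) • Measure.dirac (p (t + 1)) +
      ENNReal.ofReal (1 - μ (t + 1)) • onlineMeasure μ p t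

section OnlineMeasure

variable {T : Type*} [MeasurableSpace T] {μ : ℕ → ℝ} {p : ℕ → T}

theorem isProbabilityMeasure_onlineMeasure (hμ : ∀ t, μ t ∈ Set.Ioo (0 : ℝ) 1) (t : ℕ) :
    IsProbabilityMeasure (onlineMeasure μ p t) := by
  induction t with
  | zero => exact Measure.dirac.isProbabilityMeasure
  | succ t ih =>
    constructor
    have h := hμ (t + 1)
    simp only [onlineMeasure, Measure.coe_add, Measure.coe_smul, Pi.add_apply, Pi.smul_apply,
      measure_univ, smul_eq_mul, mul_one]
    rw [← ENNReal.ofReal_add h.1.le (by linarith [h.2])]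
    simp

variable [MeasurableSingletonClass T]

theorem ae_onlineMeasure {P : T → Prop} (hP : ∀ s, P (p s)) (t : ℕ) :
    ∀ᵐ q ∂onlineMeasure μ p t, P q := by
  have hd : ∀ s, ∀ᵐ q ∂Measure.dirac (p s), P q := fun s => by
    rw [ae_dirac_eq]; exact hP s
  induction t with
  | zero => exact hd 0
  | succ t ih =>
    rw [onlineMeasure, ae_add_measure_iff]
    exact ⟨Measure.ae_smul_measure (hd _) _, Measure.ae_smul_measure ih _⟩

/-- A finite combination of Dirac masses integrates every function, so no measurability of `g` is
needed. -/
theorem integrable_onlineMeasure {E : Type*} [NormedAddCommGroup E] (g : T → E) (t : ℕ) :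
    Integrable g (onlineMeasure μ p t) := by
  have hd : ∀ s, Integrable g (Measure.dirac (p s)) := fun s =>
    integrable_dirac (by simp)
  induction t with
  | zero => exact hd 0
  | succ t ih =>
    exact ((hd _).smul_measure ENNReal.ofReal_ne_top).add_measure
      (ih.smul_measure ENNReal.ofReal_ne_top)

theorem integral_onlineMeasure {E : Type*} [NormedAddCommGroup E] [NormedSpace ℝ E]
    [CompleteSpace E] (hμ : ∀ t, μ t ∈ Set.Ioo (0 : ℝ) 1) (g : T → E)
    (t : ℕ) :
    ∫ q, g q ∂onlineMeasure μ p t = onlineAverage μ (fun s => g (p s)) t := by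
  induction t with
  | zero => exact integral_dirac _ _
  | succ t ih =>
    have h := hμ (t + 1)
    have hd : Integrable g (Measure.dirac (p (t + 1))) := integrable_dirac (by simp)
    rw [onlineMeasure, integral_add_measure (hd.smul_measure ENNReal.ofReal_ne_top)
      ((integrable_onlineMeasure g t).smul_measure ENNReal.ofReal_ne_top), integral_smul_measure,
      integral_smul_measure, integral_dirac, ih, ENNReal.toReal_ofReal h.1.le,
      ENNReal.toReal_ofReal (by linarith [h.2])]
    rfl

end OnlineMeasure

/-! ### Uniform convergence of equi-Lipschitz families -/

/-- `h β p` is bounded and Lipschitz in `β` on bounded sets, uniformly in `p ∈ G`. -/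
def LocallyEquiLipschitz {E T : Type*} [NormedAddCommGroup E] (h : E → T → ℝ) (G : Set T) : Prop :=
  ∀ R : ℝ, ∃ M : ℝ, 0 ≤ M ∧ ∀ p ∈ G, ∀ β, ‖β‖ ≤ R →
    |h β p| ≤ M ∧ ∀ γ, ‖γ‖ ≤ R → |h β p - h γ p| ≤ M * ‖β - γ‖

/-- `M` is chosen before `ν`, so one constant serves `Λ` and all the random empirical measures. -/
theorem LocallyEquiLipschitz.integral_sub_le {E T : Type*} [NormedAddCommGroup E]
    [MeasurableSpace T] {h : E → T → ℝ} {G : Set T} (hh : LocallyEquiLipschitz h G) (R : ℝ) :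
    ∃ M : ℝ, 0 ≤ M ∧ ∀ ν : Measure T, IsProbabilityMeasure ν → (∀ᵐ p ∂ν, p ∈ G) →
      (∀ β, Integrable (h β) ν) → ∀ β γ, ‖β‖ ≤ R → ‖γ‖ ≤ R →
      |∫ p, h β p ∂ν - ∫ p, h γ p ∂ν| ≤ M * ‖β - γ‖ := by
  obtain ⟨M, hM0, hM⟩ := hh R
  refine ⟨M, hM0, fun ν _ hG hint β γ hβ hγ => ?_⟩
  rw [← integral_sub (hint β) (hint γ)]
  have hle : ∀ᵐ p ∂ν, ‖h β p - h γ p‖ ≤ M * ‖β - γ‖ := by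
    filter_upwards [hG] with p hp
    exact (hM p hp β hβ).2 γ hγ
  simpa using norm_integral_le_of_norm_le_const hle

theorem LocallyEquiLipschitz.integrable {E T : Type*} [NormedAddCommGroup E]
    [MeasurableSpace T] {h : E → T → ℝ} {G : Set T} (hh : LocallyEquiLipschitz h G)
    {ν : Measure T} [IsProbabilityMeasure ν] (hG : ∀ᵐ p ∂ν, p ∈ G) {β : E}
    (hm : AEStronglyMeasurable (h β) ν) : Integrable (h β) ν := by
  obtain ⟨M, -, hM⟩ := hh ‖β‖
  refine Integrable.of_bound hm M ?_
  filter_upwards [hG] with p hp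
  exact (hM p hp β le_rfl).1

/-- A three-term estimate over a finite net of points of `D`: two Lipschitz errors of at most `ε /
4` and one pointwise error below `ε / 2`. -/
theorem tendstoUniformlyOn_of_locally_lipschitz {E : Type*} [NormedAddCommGroup E]
    {F : ℕ → E → ℝ} {F₀ : E → ℝ}
    (hF : ∀ R : ℝ, ∃ M : ℝ, 0 ≤ M ∧ ∀ β γ, ‖β‖ ≤ R → ‖γ‖ ≤ R →
      |F₀ β - F₀ γ| ≤ M * ‖β - γ‖ ∧ ∀ t, |F t β - F t γ| ≤ M * ‖β - γ‖)
    {D : Set E} (hD : Dense D) (hlim : ∀ d ∈ D, Tendsto (fun t => F t d) atTop (𝓝 (F₀ d)))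
    {K : Set E} (hK : IsCompact K) : TendstoUniformlyOn F F₀ atTop K := by
  rw [Metric.tendstoUniformlyOn_iff]
  intro ε hε
  obtain ⟨R, hR⟩ := hK.isBounded.exists_norm_le
  -- Net points may lie outside `K`, but within `δ ≤ 1` of it.
  obtain ⟨M, hM0, hM⟩ := hF (R + 1)
  set δ := min 1 (ε / (4 * (M + 1))) with hδ
  have hδ0 : 0 < δ := by positivity
  have hMδ : M * δ ≤ ε / 4 := by
    calc M * δ ≤ (M + 1) * (ε / (4 * (M + 1))) :=
          mul_le_mul (by linarith) (min_le_right _ _) hδ0.le (by linarith)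
      _ = ε / 4 := by field_simp
  obtain ⟨s, hs⟩ := hK.elim_finite_subcover (fun d : D => Metric.ball (d : E) δ)
    (fun _ => Metric.isOpen_ball) fun β _ => by
      obtain ⟨d, hd, hβd⟩ := hD.exists_dist_lt β hδ0
      exact Set.mem_iUnion.2 ⟨⟨d, hd⟩, hβd⟩
  have hev : ∀ᶠ t in atTop, ∀ d ∈ s, |F t d - F₀ d| < ε / 2 := by
    rw [eventually_all_finset]
    intro d _
    exact (Metric.tendsto_nhds.1 (hlim d d.2)) (ε / 2) (by positivity)
  filter_upwards [hev] with t ht β hβ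
  obtain ⟨d, hds, hβd⟩ := Set.mem_iUnion₂.1 (hs hβ)
  rw [Metric.mem_ball, dist_eq_norm] at hβd
  have hβR : ‖β‖ ≤ R + 1 := (hR β hβ).trans (by linarith)
  have hdR : ‖(d : E)‖ ≤ R + 1 := by
    have h1 : ‖(d : E)‖ ≤ ‖β‖ + ‖β - d‖ := by
      rw [norm_sub_rev]; exact norm_le_norm_add_norm_sub' _ _
    linarith [hR β hβ, min_le_left 1 (ε / (4 * (M + 1)))]
  have h1 := hM β d hβR hdR
  have h2 : M * ‖β - d‖ ≤ ε / 4 := (mul_le_mul_of_nonneg_left hβd.le hM0).trans hMδ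
  have h3 := ht d hds
  have h4 := h1.1
  have h5 := h1.2 t
  rw [Real.dist_eq]
  rw [abs_lt] at h3 ⊢
  rw [abs_le] at h4 h5
  constructor <;> linarith

/-- A uniform law of large numbers for exponentially weighted averages. -/
theorem ae_tendstoUniformlyOn_onlineAverage {E T S : Type*} [NormedAddCommGroup E]
    [TopologicalSpace.SeparableSpace E]
    [MeasurableSpace T] [MeasurableSingletonClass T] [MeasurableSpace S]
    {Λ : Measure T} [IsProbabilityMeasure Λ] {Pr : Measure S} [IsProbabilityMeasure Pr]
    {ξ : ℕ → S → T} (hξ_law : ∀ t, HasLaw (ξ t) Λ Pr) (hξ_indep : iIndepFun ξ Pr)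
    {μ : ℕ → ℝ} (hμ : ∀ t, μ t ∈ Set.Ioo (0 : ℝ) 1)
    (hμ_sum : Tendsto (fun T => ∑ t ∈ Finset.range T, μ t) atTop atTop)
    (hμ_sq : Summable (fun t => μ t ^ 2))
    {G : Set T} (hG : MeasurableSet G) (hΛ : ∀ᵐ p ∂Λ, p ∈ G)
    {h : E → T → ℝ} (hh : LocallyEquiLipschitz h G) (hm : ∀ β, AEStronglyMeasurable (h β) Λ) :
    ∀ᵐ ω ∂Pr, ∀ K : Set E, IsCompact K →
      TendstoUniformlyOn (fun t β => onlineAverage μ (fun s => h β (ξ s ω)) t)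
        (fun β => ∫ p, h β p ∂Λ) atTop K := by
  -- Countability of `D` leaves a single null set, independent of `K`.
  obtain ⟨D, hDc, hDd⟩ := TopologicalSpace.exists_countable_dense E
  have hξG : ∀ t, ∀ᵐ ω ∂Pr, ξ t ω ∈ G := fun t =>
    ((hξ_law t).ae_iff (p := (· ∈ G)) hG.mem).2 hΛ
  have hpt : ∀ β, ∀ᵐ ω ∂Pr, Tendsto (fun t => onlineAverage μ (fun s => h β (ξ s ω)) t) atTop
      (𝓝 (∫ p, h β p ∂Λ)) := fun β => by
    obtain ⟨M, -, hM⟩ := hh ‖β‖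
    exact ae_tendsto_onlineAverage hξ_law hξ_indep hμ hμ_sum hμ_sq (hm β).aemeasurable
      (hΛ.mono fun p hp => (hM p hp β le_rfl).1)
  filter_upwards [ae_all_iff.2 hξG, (ae_ball_iff hDc).2 fun β _ => hpt β] with ω hω hlim K hK
  refine tendstoUniformlyOn_of_locally_lipschitz (fun R => ?_) hDd hlim hK
  obtain ⟨M, hM0, hM⟩ := hh.integral_sub_le R
  refine ⟨M, hM0, fun β γ hβ hγ => ⟨hM Λ inferInstance hΛ (fun β => hh.integrable hΛ (hm β))
    β γ hβ hγ, fun t => ?_⟩⟩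
  have := hM (onlineMeasure μ (fun s => ξ s ω) t) (isProbabilityMeasure_onlineMeasure hμ t)
    (ae_onlineMeasure hω t) (fun β => integrable_onlineMeasure _ t) β γ hβ hγ
  simpa only [integral_onlineMeasure hμ] using this

/-! ### Smooth convex functions of one variable -/

theorem ConvexOn.add_deriv_mul_sub_le {φ : ℝ → ℝ} (hφ : ConvexOn ℝ Set.univ φ)
    (hd : Differentiable ℝ φ) (a b : ℝ) : φ a + deriv φ a * (b - a) ≤ φ b := by
  rcases lt_trichotomy a b with h | rfl | h
  · have := hφ.deriv_le_slope (Set.mem_univ a) (Set.mem_univ b) h (hd a)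
    rw [slope_def_field, le_div_iff₀ (sub_pos.2 h)] at this
    linarith
  · simp
  · have := hφ.slope_le_deriv (Set.mem_univ b) (Set.mem_univ a) h (hd a)
    rw [slope_def_field, div_le_iff₀ (sub_pos.2 h)] at this
    linarith

/-- The mean value theorem gives the constant `L` in place of the sharp `L / 2`, which is enough
here. -/
theorem le_add_deriv_mul_sub_of_lipschitzWith {φ : ℝ → ℝ} {L : ℝ≥0} (hd : Differentiable ℝ φ)
    (hL : LipschitzWith L (deriv φ)) (a b : ℝ) :
    φ b ≤ φ a + deriv φ a * (b - a) + L * (b - a) ^ 2 := by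
  obtain ⟨c, hc, hcab⟩ : ∃ c, |c - a| ≤ |b - a| ∧ φ b - φ a = deriv φ c * (b - a) := by
    rcases lt_trichotomy a b with h | rfl | h
    · obtain ⟨c, hc, hc'⟩ := exists_deriv_eq_slope φ h hd.continuous.continuousOn
        hd.differentiableOn
      refine ⟨c, ?_, ?_⟩
      · rw [abs_of_pos (sub_pos.2 hc.1), abs_of_pos (sub_pos.2 h)]; linarith [hc.2]
      · rw [hc', div_mul_cancel₀ _ (sub_pos.2 h).ne']
    · exact ⟨a, le_rfl, by simp⟩
    · obtain ⟨c, hc, hc'⟩ := exists_deriv_eq_slope φ h hd.continuous.continuousOn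
        hd.differentiableOn
      refine ⟨c, ?_, ?_⟩
      · rw [abs_of_neg (sub_neg.2 hc.2), abs_of_neg (sub_neg.2 h)]; linarith [hc.1]
      · have : a - b ≠ 0 := (sub_pos.2 h).ne'
        rw [hc']; field_simp; ring
  have h1 : |deriv φ c - deriv φ a| ≤ L * |b - a| := by
    have := hL.dist_le_mul c a
    rw [Real.dist_eq, Real.dist_eq] at this
    exact this.trans (mul_le_mul_of_nonneg_left hc L.2)
  have h2 : (deriv φ c - deriv φ a) * (b - a) ≤ L * (b - a) ^ 2 := by
    calc (deriv φ c - deriv φ a) * (b - a) ≤ |deriv φ c - deriv φ a| * |b - a| := by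
          rw [← abs_mul]; exact le_abs_self _
      _ ≤ L * |b - a| * |b - a| := mul_le_mul_of_nonneg_right h1 (abs_nonneg _)
      _ = L * (b - a) ^ 2 := by rw [← sq_abs (b - a)]; ring
  linarith

/-- Cocoercivity of the derivative, with a non-optimal constant. -/
theorem ConvexOn.sq_deriv_sub_le {φ : ℝ → ℝ} {L : ℝ≥0} (hφ : ConvexOn ℝ Set.univ φ)
    (hd : Differentiable ℝ φ) (hL : LipschitzWith L (deriv φ)) (m a : ℝ) :
    (deriv φ a - deriv φ m) ^ 2 ≤ 4 * L * (φ a - φ m - deriv φ m * (a - m)) := by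
  rcases eq_or_ne L 0 with rfl | hL0
  · have := hL.dist_le_mul a m
    have h0 : deriv φ a - deriv φ m = 0 := by
      simpa [sub_eq_zero] using this
    simp [h0]
  have hLpos : (0 : ℝ) < L := by positivity
  set d := deriv φ a - deriv φ m with hdd
  -- A gradient step for `φ` minus its tangent at `m`: `b` minimizes the quadratic upper bound from
  -- `a`, which is then compared with the tangent lower bound from `m`.
  set b := a - d / (2 * L) with hb
  have h1 := le_add_deriv_mul_sub_of_lipschitzWith hd hL a b
  have h2 := hφ.add_deriv_mul_sub_le hd m b
  have h3 : b - a = - (d / (2 * L)) := by rw [hb]; ring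
  have h4 : b - m = (a - m) - d / (2 * L) := by rw [hb]; ring
  rw [h3] at h1
  rw [h4] at h2
  have h5 : deriv φ a = d + deriv φ m := by rw [hdd]; ring
  rw [h5] at h1
  have h6 : d * (d / (2 * L)) - L * (d / (2 * L)) ^ 2 ≤ φ a - φ m - deriv φ m * (a - m) := by
    linarith
  have h7 : d * (d / (2 * L)) - L * (d / (2 * L)) ^ 2 = d ^ 2 / (4 * L) := by
    field_simp; ring
  rw [h7, div_le_iff₀ (by positivity)] at h6
  linarith

/-- Cocoercivity is used from the midpoint towards both ends. The first-order terms cancel, and `(u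
- v) ^ 2 ≤ 2 * u ^ 2 + 2 * v ^ 2` doubles the constant. -/
theorem ConvexOn.sq_deriv_sub_le_midpoint {φ : ℝ → ℝ} {L : ℝ≥0} (hφ : ConvexOn ℝ Set.univ φ)
    (hd : Differentiable ℝ φ) (hL : LipschitzWith L (deriv φ)) (a b : ℝ) :
    (deriv φ a - deriv φ b) ^ 2 ≤ 8 * L * (φ a + φ b - 2 * φ ((a + b) / 2)) := by
  have h1 := hφ.sq_deriv_sub_le hd hL ((a + b) / 2) a
  have h2 := hφ.sq_deriv_sub_le hd hL ((a + b) / 2) b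
  nlinarith [sq_nonneg ((deriv φ a - deriv φ ((a + b) / 2)) + (deriv φ b - deriv φ ((a + b) / 2)))]

/-! ### Bounds on the loss -/

namespace IsSmoothConvexLoss

variable {f : ℝ → ℝ → ℝ} {𝒴 : Set ℝ} {L : ℝ≥0}

/-- Tangents at `0` compared with the values at `0` and `±1` bound the derivative at `0` uniformly
in `y`; the Lipschitz condition carries the bound to `|z| ≤ R`. -/
theorem exists_deriv_bound (hf : IsSmoothConvexLoss f 𝒴 L) (R : ℝ) :
    ∃ M : ℝ, 0 ≤ M ∧ ∀ y ∈ 𝒴, ∀ z, |z| ≤ R → |deriv (fun z => f z y) z| ≤ M := by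
  obtain ⟨B₀, hB₀⟩ := hf.bounded 0
  obtain ⟨B₁, hB₁⟩ := hf.bounded 1
  obtain ⟨B₂, hB₂⟩ := hf.bounded (-1)
  have key : ∀ y ∈ 𝒴, ∀ z, |z| ≤ R →
      |deriv (fun z => f z y) z| ≤ |B₀| + |B₁| + |B₂| + L * |R| := by
    intro y hy z hz
    have h0 := abs_le.1 ((hB₀ y hy).trans (le_abs_self _))
    have h1 := abs_le.1 ((hB₁ y hy).trans (le_abs_self _))
    have h2 := abs_le.1 ((hB₂ y hy).trans (le_abs_self _))
    have ht1 := (hf.convex y hy).add_deriv_mul_sub_le (hf.differentiable y hy) 0 1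
    have ht2 := (hf.convex y hy).add_deriv_mul_sub_le (hf.differentiable y hy) 0 (-1)
    have hlip := (hf.lipschitz y hy).dist_le_mul z 0
    rw [Real.dist_eq, Real.dist_eq, sub_zero] at hlip
    have h3 : (L : ℝ) * |z| ≤ L * |R| := mul_le_mul_of_nonneg_left (hz.trans (le_abs_self _)) L.2
    have h4 := abs_le.1 (hlip.trans h3)
    rw [abs_le]
    constructor <;> linarith [abs_nonneg B₁, abs_nonneg B₂]
  exact ⟨_, by positivity, key⟩

theorem exists_bound (hf : IsSmoothConvexLoss f 𝒴 L) (R : ℝ) :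
    ∃ M : ℝ, 0 ≤ M ∧ ∀ y ∈ 𝒴, ∀ z, |z| ≤ R → |f z y| ≤ M ∧ |deriv (fun z => f z y) z| ≤ M ∧
      ∀ w, |w| ≤ R → |f z y - f w y| ≤ M * |z - w| := by
  obtain ⟨M, hM0, hM⟩ := hf.exists_deriv_bound R
  obtain ⟨B, hB⟩ := hf.bounded 0
  have hlip : ∀ y ∈ 𝒴, ∀ z, |z| ≤ R → ∀ w, |w| ≤ R → |f z y - f w y| ≤ M * |z - w| := by
    intro y hy z hz w hw
    have hball : ∀ x, |x| ≤ R ↔ x ∈ Metric.closedBall (0 : ℝ) R := by simp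
    exact (convex_closedBall (0 : ℝ) R).norm_image_sub_le_of_norm_deriv_le
      (f := fun z => f z y) (fun x _ => hf.differentiable y hy x)
      (fun x hx => hM y hy x ((hball x).2 hx)) ((hball w).1 hw) ((hball z).1 hz)
  refine ⟨M + (|B| + M * |R|), by positivity, fun y hy z hz => ⟨?_, ?_, fun w hw => ?_⟩⟩
  · have hR : |(0 : ℝ)| ≤ R := by simpa using (abs_nonneg z).trans hz
    have h1 := hlip y hy z hz 0 hR
    rw [sub_zero] at h1
    have h2 : M * |z| ≤ M * |R| := mul_le_mul_of_nonneg_left (hz.trans (le_abs_self _)) hM0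
    have h3 := abs_sub_abs_le_abs_sub (f z y) (f 0 y)
    linarith [hB y hy, le_abs_self B]
  · have := hM y hy z hz
    have : 0 ≤ |B| + M * |R| := by positivity
    linarith
  · refine (hlip y hy z hz w hw).trans (mul_le_mul_of_nonneg_right ?_ (abs_nonneg _))
    have : 0 ≤ |B| + M * |R| := by positivity
    linarith

/-- Carathéodory: continuity in `z` and measurability in `y` give joint measurability. The indicator
discards labels outside `𝒴`, where nothing is known about `f`. -/
theorem measurable_uncurry_indicator (hf : IsSmoothConvexLoss f 𝒴 L) (h𝒴 : MeasurableSet 𝒴) :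
    Measurable (fun q : ℝ × ℝ => 𝒴.indicator (f q.1) q.2) := by
  refine measurable_uncurry_of_continuous_of_measurable
    (u := fun z y => 𝒴.indicator (f z) y) (fun y => ?_) fun z => ?_
  · by_cases hy : y ∈ 𝒴
    · simpa [Set.indicator, hy] using (hf.differentiable y hy).continuous
    · simpa [Set.indicator, hy] using continuous_const
  · refine measurable_of_restrict_of_restrict_compl h𝒴 ?_ ?_
    · convert hf.measurable z using 1
      ext y
      simp
    · convert measurable_zero using 1
      ext y
      exact Set.indicator_of_notMem y.2 _

end IsSmoothConvexLoss

/-! ### Sample losses and gradients -/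

theorem abs_dotProduct_le {n : ℕ} {r : ℝ} {x : Fin n → ℝ} (hx : ‖x‖ ≤ r) (β : Fin n → ℝ) :
    |dotProduct x β| ≤ n * r * ‖β‖ := by
  calc |dotProduct x β| ≤ ∑ i, |x i * β i| := Finset.abs_sum_le_sum_abs _ _
    _ ≤ ∑ _i : Fin n, r * ‖β‖ := by
        refine Finset.sum_le_sum fun i _ => ?_
        rw [abs_mul]
        exact mul_le_mul ((norm_le_pi_norm x i).trans hx) (norm_le_pi_norm β i) (abs_nonneg _)
          ((norm_nonneg x).trans hx)
    _ = n * r * ‖β‖ := by simp [mul_assoc]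

theorem abs_dotProduct_sub_le {n : ℕ} {r : ℝ} {x : Fin n → ℝ} (hx : ‖x‖ ≤ r) (β γ : Fin n → ℝ) :
    |dotProduct x β - dotProduct x γ| ≤ n * r * ‖β - γ‖ := by
  rw [← dotProduct_sub]
  exact abs_dotProduct_le hx _

/-- The samples with features bounded by `r` and labels in `𝒴`. -/
def boundedSamples (n : ℕ) (r : ℝ) (𝒴 : Set ℝ) : Set ((Fin n → ℝ) × ℝ) :=
  {p | ‖p.1‖ ≤ r ∧ p.2 ∈ 𝒴}

theorem measurableSet_boundedSamples (n : ℕ) (r : ℝ) {𝒴 : Set ℝ} (h𝒴 : MeasurableSet 𝒴) :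
    MeasurableSet (boundedSamples n r 𝒴) :=
  (measurableSet_le measurable_fst.norm measurable_const).inter (measurable_snd h𝒴)

namespace IsSmoothConvexLoss

variable {n : ℕ} {f : ℝ → ℝ → ℝ} {𝒴 : Set ℝ} {L : ℝ≥0} {r : ℝ}
  {ν : Measure ((Fin n → ℝ) × ℝ)}

theorem locallyEquiLipschitz_sampleLoss (hf : IsSmoothConvexLoss f 𝒴 L) (hr : 0 ≤ r) :
    LocallyEquiLipschitz (sampleLoss (n := n) f) (boundedSamples n r 𝒴) := by
  intro R
  obtain ⟨M, hM0, hM⟩ := hf.exists_bound (n * r * R)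
  have hz : ∀ x β : Fin n → ℝ, ‖x‖ ≤ r → ‖β‖ ≤ R → |dotProduct x β| ≤ n * r * R :=
    fun x β hx hβ => (abs_dotProduct_le hx β).trans
      (mul_le_mul_of_nonneg_left hβ (by positivity))
  refine ⟨M + M * (n * r), by positivity, fun p hp β hβ => ⟨?_, fun γ hγ => ?_⟩⟩
  · have : 0 ≤ M * (n * r) := by positivity
    exact (hM p.2 hp.2 _ (hz p.1 β hp.1 hβ)).1.trans (by linarith)
  · refine ((hM p.2 hp.2 _ (hz p.1 β hp.1 hβ)).2.2 _ (hz p.1 γ hp.1 hγ)).trans ?_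
    calc M * |dotProduct p.1 β - dotProduct p.1 γ| ≤ M * (n * r * ‖β - γ‖) :=
          mul_le_mul_of_nonneg_left (abs_dotProduct_sub_le hp.1 β γ) hM0
      _ = M * (n * r) * ‖β - γ‖ := by ring
      _ ≤ (M + M * (n * r)) * ‖β - γ‖ :=
          mul_le_mul_of_nonneg_right (by linarith) (norm_nonneg _)

theorem locallyEquiLipschitz_sampleGrad (hf : IsSmoothConvexLoss f 𝒴 L) (hr : 0 ≤ r)
    (i : Fin n) :
    LocallyEquiLipschitz (fun β p => sampleGrad f β p i) (boundedSamples n r 𝒴) := by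
  intro R
  obtain ⟨M, hM0, hM⟩ := hf.exists_bound (n * r * R)
  have hz : ∀ x β : Fin n → ℝ, ‖x‖ ≤ r → ‖β‖ ≤ R → |dotProduct x β| ≤ n * r * R :=
    fun x β hx hβ => (abs_dotProduct_le hx β).trans
      (mul_le_mul_of_nonneg_left hβ (by positivity))
  refine ⟨M * r + L * (n * r) * r, by positivity, fun p hp β hβ => ?_⟩
  have hpi : |p.1 i| ≤ r := (norm_le_pi_norm p.1 i).trans hp.1
  have hLr : 0 ≤ L * (n * r) * r := by positivity
  have hMr : 0 ≤ M * r := by positivity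
  refine ⟨?_, fun γ hγ => ?_⟩
  · simp only [sampleGrad, Pi.smul_apply, smul_eq_mul, abs_mul]
    have := mul_le_mul (hM p.2 hp.2 _ (hz p.1 β hp.1 hβ)).2.1 hpi (abs_nonneg _) hM0
    linarith
  · simp only [sampleGrad, Pi.smul_apply, smul_eq_mul]
    rw [← sub_mul, abs_mul]
    have h1 := (hf.lipschitz p.2 hp.2).dist_le_mul (dotProduct p.1 β) (dotProduct p.1 γ)
    rw [Real.dist_eq, Real.dist_eq] at h1
    have h2 := h1.trans (mul_le_mul_of_nonneg_left (abs_dotProduct_sub_le hp.1 β γ) L.2)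
    calc _ ≤ L * (n * r * ‖β - γ‖) * r := mul_le_mul h2 hpi (abs_nonneg _) (by positivity)
      _ = L * (n * r) * r * ‖β - γ‖ := by ring
      _ ≤ _ := mul_le_mul_of_nonneg_right (by linarith) (norm_nonneg _)

theorem aemeasurable_comp (hf : IsSmoothConvexLoss f 𝒴 L) (h𝒴 : MeasurableSet 𝒴)
    (hν : ∀ᵐ p ∂ν, p ∈ boundedSamples n r 𝒴) {z : (Fin n → ℝ) × ℝ → ℝ} (hz : Measurable z) :
    AEMeasurable (fun p => f (z p) p.2) ν := by
  refine AEMeasurable.congr ((hf.measurable_uncurry_indicator h𝒴).comp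
    (hz.prodMk measurable_snd)).aemeasurable ?_
  filter_upwards [hν] with p hp
  exact Set.indicator_of_mem hp.2 _

theorem measurable_fst_dotProduct (β : Fin n → ℝ) :
    Measurable (fun p : (Fin n → ℝ) × ℝ => dotProduct p.1 β) := by
  unfold dotProduct
  fun_prop

theorem aestronglyMeasurable_sampleLoss (hf : IsSmoothConvexLoss f 𝒴 L) (h𝒴 : MeasurableSet 𝒴)
    (hν : ∀ᵐ p ∂ν, p ∈ boundedSamples n r 𝒴) (β : Fin n → ℝ) :
    AEStronglyMeasurable (sampleLoss f β) ν :=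
  (hf.aemeasurable_comp h𝒴 hν (measurable_fst_dotProduct β)).aestronglyMeasurable

/-- The derivative is an a.e. limit of difference quotients with steps `1 / (k + 1)`. -/
theorem aemeasurable_deriv (hf : IsSmoothConvexLoss f 𝒴 L) (h𝒴 : MeasurableSet 𝒴)
    (hν : ∀ᵐ p ∂ν, p ∈ boundedSamples n r 𝒴) (β : Fin n → ℝ) :
    AEMeasurable (fun p => deriv (fun z => f z p.2) (dotProduct p.1 β)) ν := by
  have hu : Tendsto (fun k : ℕ => 1 / ((k : ℝ) + 1)) atTop (𝓝[≠] 0) :=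
    tendsto_nhdsWithin_iff.2 ⟨tendsto_one_div_add_atTop_nhds_zero_nat,
      Eventually.of_forall fun k => (by positivity : 1 / ((k : ℝ) + 1) ≠ 0)⟩
  refine aemeasurable_of_tendsto_metrizable_ae (atTop : Filter ℕ)
    (f := fun (k : ℕ) (p : (Fin n → ℝ) × ℝ) => (1 / ((k : ℝ) + 1))⁻¹ *
      (f (dotProduct p.1 β + 1 / ((k : ℝ) + 1)) p.2 - f (dotProduct p.1 β) p.2)) (fun k => ?_) ?_
  · exact ((hf.aemeasurable_comp h𝒴 hν ((measurable_fst_dotProduct β).add_const _)).sub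
      (hf.aemeasurable_comp h𝒴 hν (measurable_fst_dotProduct β))).const_mul _
  · filter_upwards [hν] with p hp
    have := (hf.differentiable p.2 hp.2 (dotProduct p.1 β)).hasDerivAt.tendsto_slope_zero
    exact this.comp hu

theorem aestronglyMeasurable_sampleGrad_apply (hf : IsSmoothConvexLoss f 𝒴 L)
    (h𝒴 : MeasurableSet 𝒴) (hν : ∀ᵐ p ∂ν, p ∈ boundedSamples n r 𝒴) (β : Fin n → ℝ) (i : Fin n) :
    AEStronglyMeasurable (fun p => sampleGrad f β p i) ν :=
  ((hf.aemeasurable_deriv h𝒴 hν β).mul (by fun_prop)).aestronglyMeasurable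

variable [IsProbabilityMeasure ν]

theorem integrable_sampleLoss (hf : IsSmoothConvexLoss f 𝒴 L) (h𝒴 : MeasurableSet 𝒴) (hr : 0 ≤ r)
    (hν : ∀ᵐ p ∂ν, p ∈ boundedSamples n r 𝒴) (β : Fin n → ℝ) : Integrable (sampleLoss f β) ν :=
  (hf.locallyEquiLipschitz_sampleLoss hr).integrable hν
    (hf.aestronglyMeasurable_sampleLoss h𝒴 hν β)

theorem integrable_sampleGrad (hf : IsSmoothConvexLoss f 𝒴 L) (h𝒴 : MeasurableSet 𝒴) (hr : 0 ≤ r)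
    (hν : ∀ᵐ p ∂ν, p ∈ boundedSamples n r 𝒴) (β : Fin n → ℝ) : Integrable (sampleGrad f β) ν :=
  Integrable.of_eval fun i => (hf.locallyEquiLipschitz_sampleGrad hr i).integrable hν
    (hf.aestronglyMeasurable_sampleGrad_apply h𝒴 hν β i)

end IsSmoothConvexLoss

/-! ### The regularizer -/

namespace GroupDecomposableNorm

variable {n : ℕ} (Ω : GroupDecomposableNorm n)

/-- `Ω` as a seminorm on `ℝⁿ`. -/
noncomputable def toSeminorm : Seminorm ℝ (Fin n → ℝ) :=
  Seminorm.of Ω.eval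
    (fun β γ => by
      unfold eval
      rw [← Finset.sum_add_distrib]
      exact Finset.sum_le_sum fun g _ => map_add_le_add (Ω.groupNorm g) _ _)
    (fun a β => by
      unfold eval
      rw [Finset.mul_sum]
      exact Finset.sum_congr rfl fun g _ => map_smul_eq_mul (Ω.groupNorm g) a fun i => β i.1)

theorem convexOn_eval : ConvexOn ℝ Set.univ Ω.eval := Ω.toSeminorm.convexOn

theorem eval_zero : Ω.eval 0 = 0 := map_zero Ω.toSeminorm

theorem eval_smul {a : ℝ} (ha : 0 ≤ a) (β : Fin n → ℝ) : Ω.eval (a • β) = a * Ω.eval β :=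
  (map_smul_eq_mul Ω.toSeminorm a β).trans (by rw [Real.norm_of_nonneg ha]; rfl)

theorem eval_pos {β : Fin n → ℝ} (hβ : β ≠ 0) : 0 < Ω.eval β := by
  obtain ⟨i, hi⟩ := Function.ne_iff.1 hβ
  obtain ⟨g, hg, hig⟩ := Ω.groups.exists_mem (Finset.mem_univ i)
  refine Finset.sum_pos' (fun g _ => apply_nonneg _ _) ⟨⟨g, hg⟩, Finset.mem_univ _, ?_⟩
  refine (apply_nonneg _ _).lt_of_ne fun h => hi ?_
  exact congrFun (Ω.definite ⟨g, hg⟩ _ h.symm) ⟨i, hig⟩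

end GroupDecomposableNorm

/-! ### Convex functions that grow along rays -/

theorem ConvexOn.lt_of_lt_smul {E : Type*} [AddCommGroup E] [Module ℝ E] {P : E → ℝ}
    (hP : ConvexOn ℝ Set.univ P) {t : ℝ} (ht0 : 0 ≤ t) (ht1 : t ≤ 1) {β : E}
    (h : P 0 < P (t • β)) : P 0 < P β := by
  by_contra! hle
  have := hP.2 (Set.mem_univ 0) (Set.mem_univ β) (sub_nonneg.2 ht1) ht0 (by ring)
  simp only [smul_zero, zero_add, smul_eq_mul] at this
  nlinarith

theorem ConvexOn.lt_of_lt_sphere {E : Type*} [NormedAddCommGroup E] [NormedSpace ℝ E] {P : E → ℝ}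
    (hP : ConvexOn ℝ Set.univ P) {R : ℝ} (hR : 0 < R) (h : ∀ β, ‖β‖ = R → P 0 < P β) {β : E}
    (hβ : R ≤ ‖β‖) : P 0 < P β := by
  have hβ0 : 0 < ‖β‖ := hR.trans_le hβ
  refine hP.lt_of_lt_smul (t := R / ‖β‖) (by positivity) ((div_le_one hβ0).2 hβ) (h _ ?_)
  rw [norm_smul, Real.norm_of_nonneg (by positivity), div_mul_cancel₀ _ hβ0.ne']

/-- By convexity the open sets of directions that have risen above `P 0` at radius `k + 1` increase
with `k`, so compactness of the unit sphere gives one radius for all directions. -/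
theorem ConvexOn.exists_lt_of_forall_ray {E : Type*} [NormedAddCommGroup E] [NormedSpace ℝ E]
    [ProperSpace E] {P : E → ℝ} (hP : ConvexOn ℝ Set.univ P) (hc : Continuous P)
    (h : ∀ d, ‖d‖ = 1 → ∃ k : ℕ, P 0 < P (((k : ℝ) + 1) • d)) :
    ∃ R : ℝ, 0 < R ∧ ∀ β, R ≤ ‖β‖ → P 0 < P β := by
  obtain ⟨k, hk⟩ := (isCompact_sphere (0 : E) 1).elim_directed_cover
    (fun k : ℕ => {d | P 0 < P (((k : ℝ) + 1) • d)})
    (fun k => isOpen_lt continuous_const (hc.comp (continuous_const_smul _)))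
    (fun d hd => Set.mem_iUnion.2 (h d (by simpa using hd)))
    (directed_of_isDirected_le fun j k hjk d hd => by
      have hjk' : (j : ℝ) ≤ k := by exact_mod_cast hjk
      refine hP.lt_of_lt_smul (t := ((j : ℝ) + 1) / ((k : ℝ) + 1)) (by positivity)
        ((div_le_one (by positivity)).2 (by linarith)) ?_
      rw [smul_smul, div_mul_cancel₀ _ (by positivity)]
      exact hd)
  have hk0 : (0 : ℝ) < (k : ℝ) + 1 := by positivity
  refine ⟨(k : ℝ) + 1, hk0, fun β hβ => hP.lt_of_lt_sphere hk0 (fun β hβ => ?_) hβ⟩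
  have := @hk (((k : ℝ) + 1)⁻¹ • β) (by
    simp [norm_smul, hβ, abs_of_pos hk0, hk0.ne'])
  simpa only [Set.mem_ofPred_eq, smul_smul, mul_inv_cancel₀ hk0.ne', one_smul] using this

theorem exists_isMinOn_of_lt {E : Type*} [NormedAddCommGroup E] [ProperSpace E] {P : E → ℝ}
    (hc : Continuous P) {R : ℝ} (h : ∀ β, R ≤ ‖β‖ → P 0 < P β) :
    ∃ β, IsMinOn P Set.univ β := by
  refine (hc.exists_forall_le' 0 ?_).imp fun β hβ γ _ => hβ γ
  rw [Filter.Eventually, mem_cocompact]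
  refine ⟨Metric.closedBall 0 R, isCompact_closedBall _ _, fun β hβ => (h β ?_).le⟩
  simpa using (by simpa using hβ : R < ‖β‖).le

/-! ### The objective for a distribution with bounded support -/

namespace IsSmoothConvexLoss

variable {n : ℕ} {f : ℝ → ℝ → ℝ} {𝒴 : Set ℝ} {L : ℝ≥0} {r : ℝ}
  {ν : Measure ((Fin n → ℝ) × ℝ)} [IsProbabilityMeasure ν] {lam : ℝ}

theorem convexOn_expectedObjective (hf : IsSmoothConvexLoss f 𝒴 L) (h𝒴 : MeasurableSet 𝒴)
    (hr : 0 ≤ r) (hν : ∀ᵐ p ∂ν, p ∈ boundedSamples n r 𝒴) (Ω : GroupDecomposableNorm n)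
    (hlam : 0 ≤ lam) : ConvexOn ℝ Set.univ (expectedObjective f Ω lam ν) := by
  refine ConvexOn.add ⟨convex_univ, fun β _ γ _ a b ha hb hab => ?_⟩
    (Ω.convexOn_eval.smul hlam)
  have hi := hf.integrable_sampleLoss (r := r) (ν := ν) h𝒴 hr hν
  simp only [smul_eq_mul]
  rw [← integral_const_mul, ← integral_const_mul,
    ← integral_add ((hi β).const_mul a) ((hi γ).const_mul b)]
  refine integral_mono_ae (hi _) (((hi β).const_mul a).add ((hi γ).const_mul b)) ?_
  filter_upwards [hν] with p hp
  have := (hf.convex p.2 hp.2).2 (Set.mem_univ (dotProduct p.1 β))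
    (Set.mem_univ (dotProduct p.1 γ)) ha hb hab
  simpa [sampleLoss, dotProduct_add, dotProduct_smul] using this

theorem continuous_expectedObjective (hf : IsSmoothConvexLoss f 𝒴 L) (h𝒴 : MeasurableSet 𝒴)
    (hr : 0 ≤ r) (hν : ∀ᵐ p ∂ν, p ∈ boundedSamples n r 𝒴) (Ω : GroupDecomposableNorm n)
    (hlam : 0 ≤ lam) : Continuous (expectedObjective f Ω lam ν) :=
  continuousOn_univ.1 ((hf.convexOn_expectedObjective h𝒴 hr hν Ω hlam).continuousOn isOpen_univ)

/-- The recession function of the expected loss is nonnegative if each `f_y` is bounded below. -/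
theorem exists_lt_integral_sampleLoss_smul (hf : IsSmoothConvexLoss f 𝒴 L)
    (h𝒴 : MeasurableSet 𝒴) (hr : 0 ≤ r) (hν : ∀ᵐ p ∂ν, p ∈ boundedSamples n r 𝒴)
    (hbdd : ∀ y ∈ 𝒴, BddBelow (Set.range (fun z => f z y))) (d : Fin n → ℝ) {ε : ℝ} (hε : 0 < ε) :
    ∃ k : ℕ, -(ε * ((k : ℝ) + 1)) <
      ∫ p, sampleLoss f (((k : ℝ) + 1) • d) p ∂ν - ∫ p, sampleLoss f 0 p ∂ν := by
  have hi := hf.integrable_sampleLoss (r := r) (ν := ν) h𝒴 hr hν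
  set q : ℕ → (Fin n → ℝ) × ℝ → ℝ := fun k p =>
    (sampleLoss f (((k : ℝ) + 1) • d) p - sampleLoss f 0 p) / ((k : ℝ) + 1) with hq
  have hqi : ∀ k, Integrable (q k) ν := fun k => ((hi _).sub (hi 0)).div_const _
  obtain ⟨M, hM0, hM⟩ := hf.exists_deriv_bound 0
  have hlow : ∀ k, ∀ p ∈ boundedSamples n r 𝒴, -(M * (n * r * ‖d‖)) ≤ q k p := by
    intro k p hp
    have hk : (0 : ℝ) < (k : ℝ) + 1 := by positivity
    have h1 := (hf.convex p.2 hp.2).add_deriv_mul_sub_le (hf.differentiable p.2 hp.2) 0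
      (((k : ℝ) + 1) * dotProduct p.1 d)
    have h2 : |deriv (fun z => f z p.2) 0 * dotProduct p.1 d| ≤ M * (n * r * ‖d‖) := by
      rw [abs_mul]
      exact mul_le_mul (hM p.2 hp.2 0 (by simp)) (abs_dotProduct_le hp.1 d) (abs_nonneg _) hM0
    simp only [hq, sampleLoss, dotProduct_smul, dotProduct_zero, smul_eq_mul]
    rw [le_div_iff₀ hk]
    have h3 := mul_le_mul_of_nonneg_right (abs_le.1 h2).1 hk.le
    linarith
  -- The lower bounds of the `f_y` need not be uniform in `y`, so domination comes from the tangent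
  -- at `0`. It controls `q k` only from below, hence the truncation by `min`.
  have hlim : Tendsto (fun k => ∫ p, min (q k p) 0 ∂ν) atTop (𝓝 (∫ _, (0 : ℝ) ∂ν)) := by
    refine tendsto_integral_of_dominated_convergence (fun _ => M * (n * r * ‖d‖))
      (fun k => ((hqi k).inf (integrable_zero _ _ _)).aestronglyMeasurable)
      (integrable_const _) (fun k => ?_) ?_
    · filter_upwards [hν] with p hp
      rw [Real.norm_eq_abs, abs_of_nonpos (min_le_right _ _), neg_le]
      exact le_min (hlow k p hp) (neg_nonpos.2 (by positivity))
    · filter_upwards [hν] with p hp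
      obtain ⟨B, hB⟩ := hbdd p.2 hp.2
      have h1 : Tendsto (fun k : ℕ => (B - sampleLoss f 0 p) / ((k : ℝ) + 1)) atTop (𝓝 0) := by
        have := tendsto_one_div_add_atTop_nhds_zero_nat (𝕜 := ℝ)
        simpa [div_eq_mul_inv] using this.const_mul (B - sampleLoss f 0 p)
      have h2 : Tendsto (fun k : ℕ => min ((B - sampleLoss f 0 p) / ((k : ℝ) + 1)) 0) atTop
          (𝓝 0) := by
        simpa using h1.min (tendsto_const_nhds (x := (0 : ℝ)))
      refine tendsto_of_tendsto_of_tendsto_of_le_of_le h2 tendsto_const_nhds (fun k => ?_)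
        fun k => min_le_right _ _
      refine min_le_min_right _ (div_le_div_of_nonneg_right (sub_le_sub_right ?_ _)
        (by positivity))
      exact hB ⟨_, rfl⟩
  rw [integral_zero] at hlim
  obtain ⟨k, hk⟩ := (hlim.eventually_const_lt (neg_lt_zero.2 hε)).exists
  refine ⟨k, ?_⟩
  have hk0 : (0 : ℝ) < (k : ℝ) + 1 := by positivity
  have h1 : ∫ p, min (q k p) 0 ∂ν ≤ ∫ p, q k p ∂ν :=
    integral_mono ((hqi k).inf (integrable_zero _ _ _)) (hqi k) fun p => min_le_left _ _
  have h2 : ∫ p, q k p ∂ν = (∫ p, sampleLoss f (((k : ℝ) + 1) • d) p ∂ν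
      - ∫ p, sampleLoss f 0 p ∂ν) / ((k : ℝ) + 1) := by
    rw [← integral_sub (hi _) (hi 0), ← integral_div]
  have h3 := hk.trans_le (h1.trans_eq h2)
  rw [lt_div_iff₀ hk0] at h3
  linarith

/-- Along a ray in direction `d` the regularizer grows at rate `lam * Ω.eval d > 0`, while for some
`k` the loss has dropped by less than this rate times `k + 1`. -/
theorem exists_expectedObjective_zero_lt (hf : IsSmoothConvexLoss f 𝒴 L)
    (h𝒴 : MeasurableSet 𝒴) (hr : 0 ≤ r) (hν : ∀ᵐ p ∂ν, p ∈ boundedSamples n r 𝒴)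
    (hbdd : ∀ y ∈ 𝒴, BddBelow (Set.range (fun z => f z y))) (Ω : GroupDecomposableNorm n)
    (hlam : 0 < lam) :
    ∃ R : ℝ, 0 < R ∧ ∀ β, R ≤ ‖β‖ →
      expectedObjective f Ω lam ν 0 < expectedObjective f Ω lam ν β := by
  refine (hf.convexOn_expectedObjective h𝒴 hr hν Ω hlam.le).exists_lt_of_forall_ray
    (hf.continuous_expectedObjective h𝒴 hr hν Ω hlam.le) fun d hd => ?_
  have hd0 : d ≠ 0 := by rintro rfl; simp at hd
  obtain ⟨k, hk⟩ := hf.exists_lt_integral_sampleLoss_smul h𝒴 hr hν hbdd d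
    (mul_pos hlam (Ω.eval_pos hd0))
  refine ⟨k, ?_⟩
  simp only [expectedObjective, Ω.eval_smul (by positivity : (0 : ℝ) ≤ (k : ℝ) + 1), Ω.eval_zero]
  linarith

theorem exists_isMinOn_expectedObjective (hf : IsSmoothConvexLoss f 𝒴 L)
    (h𝒴 : MeasurableSet 𝒴) (hr : 0 ≤ r) (hν : ∀ᵐ p ∂ν, p ∈ boundedSamples n r 𝒴)
    (hbdd : ∀ y ∈ 𝒴, BddBelow (Set.range (fun z => f z y))) (Ω : GroupDecomposableNorm n)
    (hlam : 0 < lam) : ∃ β, IsMinOn (expectedObjective f Ω lam ν) Set.univ β := by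
  obtain ⟨R, -, hR⟩ := hf.exists_expectedObjective_zero_lt h𝒴 hr hν hbdd Ω hlam
  exact exists_isMinOn_of_lt (hf.continuous_expectedObjective h𝒴 hr hν Ω hlam.le) hR

/-- The gradient of the expected loss at a point is close to its value at a minimizer of the
objective if the point is nearly optimal. -/
theorem sq_integral_sampleGrad_sub_le (hf : IsSmoothConvexLoss f 𝒴 L)
    (h𝒴 : MeasurableSet 𝒴) (hr : 0 ≤ r) (hν : ∀ᵐ p ∂ν, p ∈ boundedSamples n r 𝒴)
    (Ω : GroupDecomposableNorm n) (hlam : 0 ≤ lam) {β : Fin n → ℝ}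
    (hβ : IsMinOn (expectedObjective f Ω lam ν) Set.univ β) (γ : Fin n → ℝ) (i : Fin n) :
    ((∫ p, sampleGrad f γ p ∂ν) i - (∫ p, sampleGrad f β p ∂ν) i) ^ 2 ≤
      8 * L * r ^ 2 * (expectedObjective f Ω lam ν γ - expectedObjective f Ω lam ν β) := by
  have hi := hf.integrable_sampleLoss (r := r) (ν := ν) h𝒴 hr hν
  have hg := hf.integrable_sampleGrad (r := r) (ν := ν) h𝒴 hr hν
  have hgi : ∀ α, Integrable (fun p => sampleGrad f α p i) ν := fun α => (hg α).eval i
  set m : Fin n → ℝ := (1 / 2 : ℝ) • γ + (1 / 2 : ℝ) • β with hm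
  set w : (Fin n → ℝ) × ℝ → ℝ := fun p => sampleGrad f γ p i - sampleGrad f β p i with hw
  have hwi : Integrable w ν := (hgi γ).sub (hgi β)
  have hgap : Integrable (fun p => 8 * L * r ^ 2 *
      (sampleLoss f γ p + sampleLoss f β p - 2 * sampleLoss f m p)) ν :=
    (((hi γ).add (hi β)).sub ((hi m).const_mul 2)).const_mul _
  have hle : ∀ᵐ p ∂ν, w p ^ 2 ≤ 8 * L * r ^ 2 *
      (sampleLoss f γ p + sampleLoss f β p - 2 * sampleLoss f m p) := by
    filter_upwards [hν] with p hp
    have h1 := (hf.convex p.2 hp.2).sq_deriv_sub_le_midpoint (hf.differentiable p.2 hp.2)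
      (hf.lipschitz p.2 hp.2) (dotProduct p.1 γ) (dotProduct p.1 β)
    have h2 : dotProduct p.1 m = (dotProduct p.1 γ + dotProduct p.1 β) / 2 := by
      rw [hm, dotProduct_add, dotProduct_smul, dotProduct_smul, smul_eq_mul, smul_eq_mul]; ring
    have h3 : (p.1 i) ^ 2 ≤ r ^ 2 := sq_le_sq.2
      (((norm_le_pi_norm p.1 i).trans hp.1).trans (le_abs_self _))
    simp only [hw, sampleGrad, sampleLoss, Pi.smul_apply, smul_eq_mul, h2]
    rw [← sub_mul, mul_pow]
    calc _ ≤ (8 * L * (f (dotProduct p.1 γ) p.2 + f (dotProduct p.1 β) p.2 -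
            2 * f ((dotProduct p.1 γ + dotProduct p.1 β) / 2) p.2)) * r ^ 2 :=
          mul_le_mul h1 h3 (sq_nonneg _) ((sq_nonneg _).trans h1)
      _ = _ := by ring
  have hw2 : MemLp w 2 ν := by
    rw [memLp_two_iff_integrable_sq hwi.aestronglyMeasurable]
    refine hgap.mono' (hwi.aestronglyMeasurable.pow 2) ?_
    filter_upwards [hle] with p hp
    rwa [Real.norm_of_nonneg (sq_nonneg _)]
  -- Jensen's inequality, read off from nonnegativity of the variance.
  have hjensen : (∫ p, w p ∂ν) ^ 2 ≤ ∫ p, w p ^ 2 ∂ν := by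
    have h1 := variance_nonneg w ν
    rw [variance_eq_sub hw2] at h1
    simpa using h1
  have h1 : (∫ p, sampleGrad f γ p ∂ν) i - (∫ p, sampleGrad f β p ∂ν) i = ∫ p, w p ∂ν := by
    rw [eval_integral fun j => (hg γ).eval j, eval_integral fun j => (hg β).eval j,
      ← integral_sub (hgi γ) (hgi β)]
  have h2 : ∫ p, 8 * L * r ^ 2 * (sampleLoss f γ p + sampleLoss f β p - 2 * sampleLoss f m p) ∂ν
      = 8 * L * r ^ 2 * (∫ p, sampleLoss f γ p ∂ν + ∫ p, sampleLoss f β p ∂ν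
        - 2 * ∫ p, sampleLoss f m p ∂ν) := by
    have h2a := integral_sub ((hi γ).add (hi β)) ((hi m).const_mul 2)
    simp only [Pi.add_apply, integral_add (hi γ) (hi β), integral_const_mul] at h2a
    rw [integral_const_mul, h2a]
  -- Convexity of `Ω` bounds the midpoint gap of the loss by that of the objective, and minimality
  -- of `β` at `m` bounds the latter by the optimality gap.
  have h3 : ∫ p, sampleLoss f γ p ∂ν + ∫ p, sampleLoss f β p ∂ν - 2 * ∫ p, sampleLoss f m p ∂ν
      ≤ expectedObjective f Ω lam ν γ - expectedObjective f Ω lam ν β := by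
    have h4 : expectedObjective f Ω lam ν β ≤ expectedObjective f Ω lam ν m := hβ (Set.mem_univ m)
    have h5 := Ω.convexOn_eval.2 (Set.mem_univ γ) (Set.mem_univ β)
      (by norm_num : (0 : ℝ) ≤ 1 / 2) (by norm_num : (0 : ℝ) ≤ 1 / 2) (by norm_num)
    have h6 := mul_le_mul_of_nonneg_left h5 hlam
    simp only [smul_eq_mul, ← hm] at h6
    simp only [expectedObjective] at h4 ⊢
    linarith
  rw [h1]
  refine hjensen.trans ((integral_mono_ae hw2.integrable_sq hgap hle).trans ?_)
  rw [h2]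
  exact mul_le_mul_of_nonneg_left h3 (by positivity)

/-- The gradient of the expected loss is the same at all minimizers of the objective. -/
theorem integral_sampleGrad_eq_of_isMinOn (hf : IsSmoothConvexLoss f 𝒴 L)
    (h𝒴 : MeasurableSet 𝒴) (hr : 0 ≤ r) (hν : ∀ᵐ p ∂ν, p ∈ boundedSamples n r 𝒴)
    (Ω : GroupDecomposableNorm n) (hlam : 0 ≤ lam) {β γ : Fin n → ℝ}
    (hβ : IsMinOn (expectedObjective f Ω lam ν) Set.univ β)
    (hγ : IsMinOn (expectedObjective f Ω lam ν) Set.univ γ) :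
    ∫ p, sampleGrad f γ p ∂ν = ∫ p, sampleGrad f β p ∂ν := by
  ext i
  have h1 := hf.sq_integral_sampleGrad_sub_le h𝒴 hr hν Ω hlam hβ γ i
  have h2 : expectedObjective f Ω lam ν γ = expectedObjective f Ω lam ν β :=
    le_antisymm (hγ (Set.mem_univ β)) (hβ (Set.mem_univ γ))
  rw [h2, sub_self, mul_zero] at h1
  exact sub_eq_zero.1 (pow_eq_zero_iff two_ne_zero |>.1 (le_antisymm h1 (sq_nonneg _)))

/-- The dual certificate exists and is unique. -/
theorem isExpectedCertificate_iff (hf : IsSmoothConvexLoss f 𝒴 L)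
    (h𝒴 : MeasurableSet 𝒴) (hr : 0 ≤ r) (hν : ∀ᵐ p ∂ν, p ∈ boundedSamples n r 𝒴)
    (Ω : GroupDecomposableNorm n) (hlam : 0 ≤ lam) {β : Fin n → ℝ}
    (hβ : IsMinOn (expectedObjective f Ω lam ν) Set.univ β) (Z : Fin n → ℝ) :
    IsExpectedCertificate f Ω lam ν Z ↔ Z = -(1 / lam) • ∫ p, sampleGrad f β p ∂ν := by
  refine ⟨?_, fun h => ⟨β, hβ, h⟩⟩
  rintro ⟨γ, hγ, rfl⟩
  rw [hf.integral_sampleGrad_eq_of_isMinOn h𝒴 hr hν Ω hlam hβ hγ]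

end IsSmoothConvexLoss

/-! ### Stability of minimizers -/

/-- On the sphere of radius `R`, `P₀` exceeds `P₀ 0` by a positive margin. Uniform convergence
passes this on to `P t`, and convexity extends it outwards, so no minimizer lies outside the ball.
-/
theorem eventually_norm_le_and_tendsto_of_isMinOn {E : Type*} [NormedAddCommGroup E]
    [NormedSpace ℝ E] [ProperSpace E] {P : ℕ → E → ℝ} {P₀ : E → ℝ} (hc : Continuous P₀)
    (hconv : ∀ t, ConvexOn ℝ Set.univ (P t)) {R : ℝ} (hR : 0 < R)
    (h : ∀ β, R ≤ ‖β‖ → P₀ 0 < P₀ β)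
    (hu : TendstoUniformlyOn P P₀ atTop (Metric.closedBall 0 R)) {b : ℕ → E}
    (hb : ∀ t, IsMinOn (P t) Set.univ (b t)) {b₀ : E} (hb₀ : IsMinOn P₀ Set.univ b₀) :
    (∀ᶠ t in atTop, ‖b t‖ ≤ R) ∧ Tendsto (fun t => P₀ (b t)) atTop (𝓝 (P₀ b₀)) := by
  have hu' : ∀ ε > 0, ∀ᶠ t in atTop, ∀ β, ‖β‖ ≤ R → |P₀ β - P t β| < ε := by
    intro ε hε
    filter_upwards [Metric.tendstoUniformlyOn_iff.1 hu ε hε] with t ht β hβ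
    exact ht β (by simpa using hβ)
  have hbR : ∀ᶠ t in atTop, ‖b t‖ ≤ R := by
    obtain ⟨a, ha, hRa⟩ := (isCompact_sphere (0 : E) R).exists_forall_le' hc.continuousOn
      (a := P₀ 0) fun β hβ => h β (by simpa using hβ.ge)
    filter_upwards [hu' ((a - P₀ 0) / 2) (by linarith)] with t ht
    by_contra! hlt
    refine ((hconv t).lt_of_lt_sphere hR (fun β hβ => ?_) hlt.le).not_ge (hb t (Set.mem_univ 0))
    have h1 := abs_lt.1 (ht 0 (by simpa using hR.le))
    have h2 := abs_lt.1 (ht β hβ.le)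
    have h3 := hRa β (by simpa using hβ)
    linarith
  refine ⟨hbR, Metric.tendsto_nhds.2 fun ε hε => ?_⟩
  have hb₀R : ‖b₀‖ ≤ R := by
    by_contra! hlt
    exact (h b₀ hlt.le).not_ge (hb₀ (Set.mem_univ 0))
  filter_upwards [hbR, hu' (ε / 2) (by positivity)] with t hbt ht
  have h1 := abs_lt.1 (ht _ hbt)
  have h2 := abs_lt.1 (ht _ hb₀R)
  have h3 : P t (b t) ≤ P t b₀ := hb t (Set.mem_univ _)
  have h4 : P₀ b₀ ≤ P₀ (b t) := hb₀ (Set.mem_univ _)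
  rw [Real.dist_eq, abs_lt]
  constructor <;> linarith

/-! ### Transfer to the online objectives and convergence of the certificates. -/

theorem onlineAverage_apply {ι : Type*} {μ : ℕ → ℝ} (a : ℕ → ι → ℝ) (t : ℕ) (i : ι) :
    onlineAverage μ a t i = onlineAverage μ (fun s => a s i) t := by
  induction t with
  | zero => rfl
  | succ t ih => simp [onlineAverage, ih]

section Online

variable {n : ℕ} {f : ℝ → ℝ → ℝ} {Ω : GroupDecomposableNorm n} {lam : ℝ} {μ : ℕ → ℝ}

theorem onlineObjective_eq (hμ : ∀ t, μ t ∈ Set.Ioo (0 : ℝ) 1) (p : ℕ → (Fin n → ℝ) × ℝ) (t : ℕ) :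
    onlineObjective f Ω lam μ p t = expectedObjective f Ω lam (onlineMeasure μ p t) := by
  funext β
  simp only [onlineObjective, expectedObjective, integral_onlineMeasure hμ]

theorem isOnlineCertificate_iff (hμ : ∀ t, μ t ∈ Set.Ioo (0 : ℝ) 1) (p : ℕ → (Fin n → ℝ) × ℝ)
    (t : ℕ) (Z : Fin n → ℝ) :
    IsOnlineCertificate f Ω lam μ p t Z ↔
      IsExpectedCertificate f Ω lam (onlineMeasure μ p t) Z := by
  simp only [IsOnlineCertificate, IsExpectedCertificate, onlineObjective_eq hμ,
    integral_onlineMeasure hμ]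

end Online

/-- If the objectives and the gradients of the expected losses converge uniformly on compact sets,
then so do the gradients at minimizers. -/
theorem IsSmoothConvexLoss.tendsto_integral_sampleGrad {n : ℕ} {f : ℝ → ℝ → ℝ} {𝒴 : Set ℝ} {L : ℝ≥0}
    {r : ℝ} {Λ : Measure ((Fin n → ℝ) × ℝ)} [IsProbabilityMeasure Λ]
    {ν : ℕ → Measure ((Fin n → ℝ) × ℝ)} [∀ t, IsProbabilityMeasure (ν t)] {lam : ℝ}
    (hf : IsSmoothConvexLoss f 𝒴 L) (h𝒴 : MeasurableSet 𝒴) (hr : 0 ≤ r)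
    (hΛ : ∀ᵐ p ∂Λ, p ∈ boundedSamples n r 𝒴) (hν : ∀ t, ∀ᵐ p ∂ν t, p ∈ boundedSamples n r 𝒴)
    (hbdd : ∀ y ∈ 𝒴, BddBelow (Set.range (fun z => f z y))) (Ω : GroupDecomposableNorm n)
    (hlam : 0 < lam)
    (hP : ∀ K : Set (Fin n → ℝ), IsCompact K →
      TendstoUniformlyOn (fun t => expectedObjective f Ω lam (ν t))
        (expectedObjective f Ω lam Λ) atTop K)
    (hG : ∀ i, ∀ K : Set (Fin n → ℝ), IsCompact K →
      TendstoUniformlyOn (fun t β => (∫ p, sampleGrad f β p ∂ν t) i)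
        (fun β => (∫ p, sampleGrad f β p ∂Λ) i) atTop K)
    {b : ℕ → Fin n → ℝ} (hb : ∀ t, IsMinOn (expectedObjective f Ω lam (ν t)) Set.univ (b t))
    {b₀ : Fin n → ℝ} (hb₀ : IsMinOn (expectedObjective f Ω lam Λ) Set.univ b₀) :
    Tendsto (fun t => ∫ p, sampleGrad f (b t) p ∂ν t) atTop (𝓝 (∫ p, sampleGrad f b₀ p ∂Λ)) := by
  obtain ⟨R, hR, hR'⟩ := hf.exists_expectedObjective_zero_lt h𝒴 hr hΛ hbdd Ω hlam
  obtain ⟨hbR, hPb⟩ := eventually_norm_le_and_tendsto_of_isMinOn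
    (hf.continuous_expectedObjective h𝒴 hr hΛ Ω hlam.le)
    (fun t => hf.convexOn_expectedObjective h𝒴 hr (hν t) Ω hlam.le) hR hR'
    (hP _ (isCompact_closedBall 0 R)) hb hb₀
  refine tendsto_pi_nhds.2 fun i => ?_
  -- The difference is split at the moving point `b t`: here the measure changes and the point is
  -- fixed, in `h2` the point changes under `Λ`. Convergence of `b t` itself is never needed.
  have h1 : Tendsto (fun t => (∫ p, sampleGrad f (b t) p ∂ν t) i
      - (∫ p, sampleGrad f (b t) p ∂Λ) i) atTop (𝓝 0) := by
    refine Metric.tendsto_nhds.2 fun ε hε => ?_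
    filter_upwards [hbR,
      Metric.tendstoUniformlyOn_iff.1 (hG i _ (isCompact_closedBall 0 R)) ε hε] with t ht htu
    have := htu (b t) (by simpa using ht)
    rw [dist_comm, Real.dist_eq] at this
    rwa [Real.dist_eq, sub_zero]
  have h2 : Tendsto (fun t => (∫ p, sampleGrad f (b t) p ∂Λ) i
      - (∫ p, sampleGrad f b₀ p ∂Λ) i) atTop (𝓝 0) := by
    have h3 : Tendsto (fun t => 8 * L * r ^ 2 *
        (expectedObjective f Ω lam Λ (b t) - expectedObjective f Ω lam Λ b₀)) atTop (𝓝 0) := by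
      simpa using (hPb.sub_const (expectedObjective f Ω lam Λ b₀)).const_mul (8 * L * r ^ 2)
    have h4 := squeeze_zero (fun t => sq_nonneg _)
      (fun t => hf.sq_integral_sampleGrad_sub_le h𝒴 hr hΛ Ω hlam.le hb₀ (b t) i) h3
    have h5 := h4.sqrt
    simp only [Real.sqrt_sq_eq_abs, Real.sqrt_zero] at h5
    exact (tendsto_zero_iff_abs_tendsto_zero _).2 h5
  simpa using (h1.add h2).add_const ((∫ p, sampleGrad f b₀ p ∂Λ) i)

/-- Vectors live in `Fin n → ℝ`, whose norm is the sup-norm. -/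
theorem proposition3p1 {n : ℕ}
    -- the data distribution, carried by a compact set
    (Λ : Measure ((Fin n → ℝ) × ℝ)) [IsProbabilityMeasure Λ]
    (𝒳 : Set (Fin n → ℝ)) (𝒴 : Set ℝ) (h𝒳 : IsCompact 𝒳) (h𝒴 : IsCompact 𝒴)
    (hΛ : ∀ᵐ p ∂Λ, p.1 ∈ 𝒳 ∧ p.2 ∈ 𝒴)
    -- the loss, the regularizer and the regularization parameter
    (f : ℝ → ℝ → ℝ) (L : ℝ≥0) (hL : 0 < L) (hf : IsSmoothConvexLoss f 𝒴 L)
    (Ω : GroupDecomposableNorm n) (lam : ℝ) (hlam : 0 < lam)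
    -- the weights
    (μ : ℕ → ℝ) (hμ : ∀ t, μ t ∈ Set.Ioo (0 : ℝ) 1)
    (hμ_sum : Tendsto (fun T => ∑ t ∈ Finset.range T, μ t) atTop atTop)
    (hμ_sq : Summable (fun t => μ t ^ 2))
    -- the samples: independent with law `Λ`
    {S : Type*} [MeasurableSpace S] (Pr : Measure S) [IsProbabilityMeasure Pr]
    (ξ : ℕ → S → (Fin n → ℝ) × ℝ) (hξ_law : ∀ t, HasLaw (ξ t) Λ Pr) (hξ_indep : iIndepFun ξ Pr) :
    -- the expectations exist
    (∀ β, Integrable (sampleLoss f β) Λ ∧ Integrable (sampleGrad f β) Λ) ∧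
    -- almost surely, the online objective converges uniformly on compact sets
    (∀ᵐ ω ∂Pr, ∀ K : Set (Fin n → ℝ), IsCompact K →
      TendstoUniformlyOn (fun t => onlineObjective f Ω lam μ (fun s => ξ s ω) t)
        (expectedObjective f Ω lam Λ) atTop K) ∧
    -- if each `f_y` is bounded below, the certificates exist, are unique, and converge
    ((∀ y ∈ 𝒴, BddBelow (Set.range (fun z => f z y))) →
      ∃ Zstar : Fin n → ℝ,
        (∀ Z, IsExpectedCertificate f Ω lam Λ Z ↔ Z = Zstar) ∧
        ∀ᵐ ω ∂Pr, ∃ Z : ℕ → Fin n → ℝ,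
          (∀ t Z', IsOnlineCertificate f Ω lam μ (fun s => ξ s ω) t Z' ↔ Z' = Z t) ∧
          Tendsto (fun t => ‖Z t - Zstar‖) atTop (𝓝 0)) := by
  have h𝒴m : MeasurableSet 𝒴 := h𝒴.measurableSet
  obtain ⟨r, hr0, hr⟩ := h𝒳.isBounded.exists_pos_norm_le
  have hΛr : ∀ᵐ p ∂Λ, p ∈ boundedSamples n r 𝒴 := hΛ.mono fun p hp => ⟨hr _ hp.1, hp.2⟩
  have hξr : ∀ᵐ ω ∂Pr, ∀ t, ξ t ω ∈ boundedSamples n r 𝒴 := ae_all_iff.2 fun t =>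
    ((hξ_law t).ae_iff (p := (· ∈ boundedSamples n r 𝒴))
      (measurableSet_boundedSamples n r h𝒴m).mem).2 hΛr
  have hloss := ae_tendstoUniformlyOn_onlineAverage hξ_law hξ_indep hμ hμ_sum hμ_sq
    (measurableSet_boundedSamples n r h𝒴m) hΛr (hf.locallyEquiLipschitz_sampleLoss hr0.le)
    (hf.aestronglyMeasurable_sampleLoss h𝒴m hΛr)
  have hgrad := ae_all_iff.2 fun i => ae_tendstoUniformlyOn_onlineAverage hξ_law hξ_indep hμ hμ_sum
    hμ_sq (measurableSet_boundedSamples n r h𝒴m) hΛr (hf.locallyEquiLipschitz_sampleGrad hr0.le i)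
    fun β => hf.aestronglyMeasurable_sampleGrad_apply h𝒴m hΛr β i
  have hobj : ∀ᵐ ω ∂Pr, ∀ K : Set (Fin n → ℝ), IsCompact K →
      TendstoUniformlyOn (fun t => onlineObjective f Ω lam μ (fun s => ξ s ω) t)
        (expectedObjective f Ω lam Λ) atTop K := by
    filter_upwards [hloss] with ω hω K hK
    rw [Metric.tendstoUniformlyOn_iff]
    intro ε hε
    filter_upwards [Metric.tendstoUniformlyOn_iff.1 (hω K hK) ε hε] with t ht β hβ
    simpa only [expectedObjective, onlineObjective, dist_add_right] using ht β hβ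
  refine ⟨fun β => ⟨hf.integrable_sampleLoss h𝒴m hr0.le hΛr β,
    hf.integrable_sampleGrad h𝒴m hr0.le hΛr β⟩, hobj, fun hbdd => ?_⟩
  obtain ⟨b₀, hb₀⟩ := hf.exists_isMinOn_expectedObjective h𝒴m hr0.le hΛr hbdd Ω hlam
  refine ⟨_, hf.isExpectedCertificate_iff h𝒴m hr0.le hΛr Ω hlam.le hb₀, ?_⟩
  -- From here on the sample path is fixed and the argument is deterministic.
  filter_upwards [hξr, hgrad, hobj] with ω hω hgω hoω
  have hprob := isProbabilityMeasure_onlineMeasure (p := fun s => ξ s ω) hμ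
  have hν : ∀ t, ∀ᵐ p ∂onlineMeasure μ (fun s => ξ s ω) t, p ∈ boundedSamples n r 𝒴 :=
    ae_onlineMeasure hω
  choose b hb using fun t => hf.exists_isMinOn_expectedObjective h𝒴m hr0.le (hν t) hbdd Ω hlam
  refine ⟨_, fun t Z => (isOnlineCertificate_iff hμ _ t Z).trans
    (hf.isExpectedCertificate_iff h𝒴m hr0.le (hν t) Ω hlam.le (hb t) Z),
    tendsto_iff_norm_sub_tendsto_zero.1 (Tendsto.const_smul ?_ _)⟩
  simp only [onlineObjective_eq hμ] at hoω
  refine hf.tendsto_integral_sampleGrad h𝒴m hr0.le hΛr hν hbdd Ω hlam hoω (fun i K hK => ?_) hb hb₀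
  have hi : ∀ β, (∫ p, sampleGrad f β p ∂Λ) i = ∫ p, sampleGrad f β p i ∂Λ := fun β =>
    eval_integral (fun j => (hf.integrable_sampleGrad h𝒴m hr0.le hΛr β).eval j) i
  simpa only [integral_onlineMeasure hμ, onlineAverage_apply, hi] using hgω i K hK
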